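/- Let $(\mathcal X,d)$ be a metric space equipped with a betweenness, i.e. a map assigning to each $x,z\in\mathcal X$ a set $\langle x,z\rangle\subset\mathcal X$ with $\langle x,z\rangle=\langle z,x\rangle$, $x\in\langle x,z\rangle$, and such that $y\in\langle x,z\rangle$ implies $\langle x,y\rangle\cap\langle y,z\rangle=\{y\}$ and $\langle x,y\rangle\cup\langle y,z\rangle=\langle x,z\rangle$. Assume that it is compatible with the topology: each $\langle x,z\rangle$ is compact and $(x,z)\mapsto\langle x,z\rangle$ is continuous for the Hausdorff topology on nonempty compact sets. Let $\mathcal R(\mathcal X):=(\mathcal X\times\mathbb R)\cup\{(\ast,-\infty),(\ast,+\infty)\}$ be equipped with any metric $\rho$ generating the same topology as $$d_{\rm sqz}\big((x,s),(y,t)\big)=\big(\phi(s)\wedge\phi(t)\big)\big(d(x,y)\wedge 1\big)+|\phi(s)-\phi(t)|+d_{\overline{\mathbb R}}(s,t)$$ (the first term being $0$ if one of the points is $(\ast,\pm\infty)$), where $d_{\overline{\mathbb R}}$ is a metric generating the topology of $[-\infty,\infty]$ and $\phi:[-\infty,\infty]\to[0,\infty)$ is continuous with $\phi(\pm\infty)=0$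 and $\phi>0$ on $\mathbb R$. For an interval $I$ with minimum $0$ and a cadlag function $f:I\to\mathcal X$ (right-continuous with left limits), write $f(t-)$ for the left limit of $f$ at $t\in I$, $t>0$, and put $f(0-):=f(0)$. The filled-in graph of $f$ is $$\mathcal G_{\rm f}(f):=\{(x,t):t\in I,\ x\in\langle f(t-),f(t)\rangle\}\cup\{(\ast,-\infty),(\ast,+\infty)\},$$ ordered by setting $(x,s)\preceq(y,t)$ if $s<t$, or if $s=t\in I$ and $x\in\langle f(t-),y\rangle$, or if $(x,s)=(y,t)$. Let $d^{\rm H}(f,g)$ be the Hausdorff distance, with respect to $\rho$, between $\mathcal G_{\rm f}(f)$ and $\mathcal G_{\rm f}(g)$, and let $$d^{\rm S}_{\rm tot}(f,g):=\inf_R\ \sup_{(z,w)\in R}\rho(z,w),$$ where the infimum is over all correspondences $R\subset\mathcal G_{\rm f}(f)\times\mathcal G_{\rm f}(g)$ (both coordinate projections are surjective) that are monotone: there are no $(z,w),(z',w')\in R$ with $z\prec z'$ and $w'\prec w$. Let $f_n$ $(n\in\mathbb N)$ and $f$ be cadlag functions $[0,\infty)\to\mathcal X$, and let $g|_{[0,t]}$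 denote the restriction of $g$ to $[0,t]$. Then $$d^{\rm H}(f_n,f)\to0\quad\Longleftrightarrow\quad d^{\rm H}\big(f_n|_{[0,t]},f|_{[0,t]}\big)\to0\quad\text{for all }t>0\text{ such that }f(t-)=f(t),$$ $$d^{\rm S}_{\rm tot}(f_n,f)\to0\quad\Longleftrightarrow\quad d^{\rm S}_{\rm tot}\big(f_n|_{[0,t]},f|_{[0,t]}\big)\to0\quad\text{for all }t>0\text{ such that }f(t-)=f(t).$$ -/

import Mathlib

open Set Filter Topology
open scoped ENNReal

noncomputable section

namespace SkorohodPath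

/-! ### Betweenness -/

/-- A betweenness on a set `X`: a function that assigns to each pair `x, z` a segment `⟨x, z⟩`. -/
structure Betweenness (X : Type*) where
  /-- the segment `⟨x, z⟩` with endpoints `x` and `z` -/
  seg : X → X → Set X
  seg_comm : ∀ x z, seg x z = seg z x
  left_mem : ∀ x z, x ∈ seg x z
  inter_eq : ∀ x y z, y ∈ seg x z → seg x y ∩ seg y z = {y}
  union_eq : ∀ x y z, y ∈ seg x z → seg x y ∪ seg y z = seg x z

/-- A betweenness is compatible with the topology if all segments are compact and
`(x, z) ↦ ⟨x, z⟩` is continuous from the product topology to the Hausdorff topology on the space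
of nonempty compact sets. -/
def Betweenness.Compatible {X : Type*} [MetricSpace X] (B : Betweenness X) : Prop :=
  ∃ hc : ∀ x z, IsCompact (B.seg x z),
    Continuous fun p : X × X =>
      (⟨⟨B.seg p.1 p.2, hc p.1 p.2⟩, ⟨p.1, B.left_mem p.1 p.2⟩⟩ :
        TopologicalSpace.NonemptyCompacts X)

/-! ### Squeezed space -/

/-- The squeezed space `(X × ℝ) ∪ {(∗, -∞), (∗, +∞)}`. -/
inductive SqueezedSpace (X : Type*) where
  | negInf : SqueezedSpace X
  | pt (x : X) (t : ℝ) : SqueezedSpace X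
  | posInf : SqueezedSpace X

namespace SqueezedSpace

variable {X : Type*}

/-- The time coordinate of a point of squeezed space. -/
def time : SqueezedSpace X → EReal
  | negInf => ⊥
  | pt _ t => (t : EReal)
  | posInf => ⊤

/-- `(φ(s) ∧ φ(t)) (d(x,y) ∧ 1)`, which is zero if one of the two points is a point at infinity. -/
def spatialPart [MetricSpace X] (φ : EReal → ℝ) : SqueezedSpace X → SqueezedSpace X → ℝ
  | pt x s, pt y t => min (φ s) (φ t) * min (dist x y) 1
  | _, _ => 0

/-- The function
`d_sqz((x,s),(y,t)) = (φ(s) ∧ φ(t)) (d(x,y) ∧ 1) + |φ(s) - φ(t)| + δ(s,t)`. -/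
def sqzDist [MetricSpace X] (δ : EReal → EReal → ℝ) (φ : EReal → ℝ)
    (z w : SqueezedSpace X) : ℝ :=
  spatialPart φ z w + |φ z.time - φ w.time| + δ z.time w.time

end SqueezedSpace

/-- `δ` is a metric on the extended real line that generates its usual topology. -/
structure IsERealMetric (δ : EReal → EReal → ℝ) : Prop where
  eq_zero_iff : ∀ a b, δ a b = 0 ↔ a = b
  symm : ∀ a b, δ a b = δ b a
  triangle : ∀ a b c, δ a c ≤ δ a b + δ b c
  nhds_basis : ∀ a, (𝓝 a).HasBasis (fun ε : ℝ => 0 < ε) fun ε => {b | δ a b < ε}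

/-- The given topology on the squeezed space of `X` is the one generated by `d_sqz`, for
some metric `δ` generating the topology of the extended real line and some
continuous `φ` that vanishes at `±∞` and is strictly positive on `ℝ`. -/
def IsSqueezedTopology (X : Type*) [MetricSpace X] [TopologicalSpace (SqueezedSpace X)] : Prop :=
  ∃ (δ : EReal → EReal → ℝ) (φ : EReal → ℝ),
    IsERealMetric δ ∧ Continuous φ ∧ φ ⊥ = 0 ∧ φ ⊤ = 0 ∧ (∀ t : ℝ, 0 < φ t) ∧
    ∀ z : SqueezedSpace X,
      (𝓝 z).HasBasis (fun ε : ℝ => 0 < ε) fun ε => {w | SqueezedSpace.sqzDist δ φ z w < ε}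

/-! ### Ordered Hausdorff distance -/

/-- `R` is a correspondence between the sets `K₁` and `K₂`. -/
def IsCorrespondence {α : Type*} (K₁ K₂ : Set α) (R : Set (α × α)) : Prop :=
  R ⊆ K₁ ×ˢ K₂ ∧ (∀ x₁ ∈ K₁, ∃ x₂ ∈ K₂, (x₁, x₂) ∈ R) ∧ (∀ x₂ ∈ K₂, ∃ x₁ ∈ K₁, (x₁, x₂) ∈ R)

/-- `R` is monotone with respect to the orders `le₁` and `le₂`: there are no
`(x₁, x₂), (y₁, y₂) ∈ R` such that `x₁ ≺ y₁` and `y₂ ≺ x₂`. -/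
def IsMonotoneCorr {α : Type*} (le₁ le₂ : α → α → Prop) (R : Set (α × α)) : Prop :=
  ¬ ∃ x ∈ R, ∃ y ∈ R, (le₁ x.1 y.1 ∧ x.1 ≠ y.1) ∧ (le₂ y.2 x.2 ∧ y.2 ≠ x.2)

/-- The metric `d_tot` between ordered sets `(K₁, le₁)` and `(K₂, le₂)`: the infimum over all
monotone correspondences `R` of the supremum over `R` of the distance. It takes values in `[0, ∞]`,
so that neither the infimum nor the supremum has a default value. -/
def orderedHausdorffEDist {α : Type*} [PseudoEMetricSpace α]
    (K₁ : Set α) (le₁ : α → α → Prop) (K₂ : Set α) (le₂ : α → α → Prop) : ℝ≥0∞ :=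
  ⨅ (R : Set (α × α)) (_ : IsCorrespondence K₁ K₂ R ∧ IsMonotoneCorr le₁ le₂ R),
    ⨆ p ∈ R, edist p.1 p.2

/-! ### Cadlag functions on an interval and their filled-in graphs -/

section Cadlag

variable {X : Type*} [MetricSpace X] {I : Set ℝ}

/-- `f : I → X` is cadlag: right-continuous with left limits. (The filters `𝓝[>] t`, `𝓝[<] t` are
trivial at the right, respectively left, endpoint of `I`.) -/
def IsCadlag (f : I → X) : Prop :=
  ∀ t : I, Tendsto f (𝓝[>] t) (𝓝 (f t)) ∧ ∃ y, Tendsto f (𝓝[<] t) (𝓝 y)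

/-- For a cadlag function `f` on an interval `I` and `t ∈ I`, `Function.leftLim f t` is the left
limit `f(t-)`, with `f(t-) = f(t)` if `t` is the left endpoint of `I`. So `f` is viewed as
the path with domain `I` and values `f(t-)` at `t-` and `f(t)` at `t+`. The filled-in graph is
`{(x,t) : t ∈ I, x ∈ ⟨f(t-), f(t)⟩} ∪ {(∗,-∞), (∗,+∞)}`. -/
def filledGraph (B : Betweenness X) (f : I → X) : Set (SqueezedSpace X) :=
  {z | ∃ (t : I) (x : X), x ∈ B.seg (Function.leftLim f t) (f t) ∧ z = .pt x t} ∪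
    {.negInf, .posInf}

/-- The total order on the filled-in graph: `(x,s) ≼ (y,t)` if `s < t`, or if `s = t` and
`x ≤ y` in the segment `⟨f(t-), f(t)⟩`, i.e. `x ∈ ⟨f(t-), y⟩`. (Equality is listed for the sake of
the points at infinity.) -/
def graphLE (B : Betweenness X) (f : I → X) (z w : SqueezedSpace X) : Prop :=
  z.time < w.time ∨ z = w ∨
    ∃ (t : I) (x y : X), z = .pt x t ∧ w = .pt y t ∧ x ∈ B.seg (Function.leftLim f t) y

/-- `d^H(f,g)`: the Hausdorff distance between the filled-in graphs. -/
def dH [MetricSpace (SqueezedSpace X)] (B : Betweenness X) (f g : I → X) : ℝ≥0∞ :=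
  Metric.hausdorffEDist (filledGraph B f) (filledGraph B g)

/-- `d^S_tot(f,g)`: the distance `d_tot` between the totally ordered filled-in graphs. -/
def dTot [MetricSpace (SqueezedSpace X)] (B : Betweenness X) (f g : I → X) : ℝ≥0∞ :=
  orderedHausdorffEDist (filledGraph B f) (graphLE B f) (filledGraph B g) (graphLE B g)

end Cadlag

/-- The space `D_I(X)`, for a closed interval `I` of positive length: cadlag functions
`f : I → X` that do not jump at the right endpoint of `I` (if there is one). -/
structure CadlagSpace (I : Set ℝ) (X : Type*) [MetricSpace X] where
  toFun : I → X
  cadlag : IsCadlag toFun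
  no_jump_at_sup : ∀ t : I, IsGreatest I (t : ℝ) → Function.leftLim toFun t = toFun t

/-- The restriction to `[0,t]` of a function on `[0,∞)`. -/
def restrictTo {X : Type*} (f : Ici (0 : ℝ) → X) (t : ℝ) : Icc (0 : ℝ) t → X :=
  fun s => f ⟨s, s.2.1⟩

end SkorohodPath

end

namespace SkorohodPath

/-! ### Topology of squeezed space -/

/-! A bound on either distance amounts to a correspondence between the filled-in graphs whose pairs
are close, required to be monotone for `dTot` and arbitrary for `dH`. It therefore suffices to turn
correspondences between full graphs into correspondences between restricted graphs and back, keeping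
pairs close and preserving monotonicity; both equivalences then follow together.

Restricting (`exists_correspondence_restrictTo`): pairs with both times at most `t` are kept. In a
pair that straddles `t`, the later point is replaced by the endpoint at time `t` of the same path.
This costs little because the graph of `f` is compact (`isCompact_filledGraph`) and, as `f(t-) =
f(t)`, has a single point at time `t`: a point of it that is close to something across `t` is close
to `(f t, t)`.

Extending (`exists_correspondence_of_restrictTo`): near `(∗, +∞)` the topology only sees time, so
everything after a large `t` is close to that point and may be matched crudely. Such a `t` can be
taken among the continuity times of `f`, since jump times are countable. -/

theorem IsERealMetric.nonneg {δ : EReal → EReal → ℝ} (hδ : IsERealMetric δ) (a b : EReal) :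
    0 ≤ δ a b := by
  have h := hδ.triangle a b a
  rw [(hδ.eq_zero_iff a a).2 rfl, hδ.symm b a] at h
  linarith

theorem IsERealMetric.tendsto_self {δ : EReal → EReal → ℝ} (hδ : IsERealMetric δ) (a : EReal) :
    Tendsto (δ a) (𝓝 a) (𝓝 0) := by
  refine tendsto_order.2 ⟨fun c hc => .of_forall fun b => hc.trans_le (hδ.nonneg a b), ?_⟩
  exact fun c hc => (hδ.nhds_basis a).mem_of_mem hc

section Squeezed

variable {X : Type*} [MetricSpace X] [TopologicalSpace (SqueezedSpace X)]

theorem continuous_time (hsqz : IsSqueezedTopology X) :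
    Continuous (SqueezedSpace.time : SqueezedSpace X → EReal) := by
  obtain ⟨δ, φ, hδ, -, hb, ht, hpos, hbasis⟩ := hsqz
  have hφ : ∀ s, 0 ≤ φ s := by
    intro s
    induction s with
    | bot => exact hb.ge
    | top => exact ht.ge
    | coe s => exact (hpos s).le
  refine continuous_iff_continuousAt.2 fun z => ?_
  refine (hbasis z).tendsto_iff (hδ.nhds_basis z.time) |>.2 fun ε hε => ⟨ε, hε, fun w hw => ?_⟩
  have hsp : 0 ≤ SqueezedSpace.spatialPart φ z w := by
    cases z <;> cases w <;> simp only [SqueezedSpace.spatialPart, le_refl]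
    exact mul_nonneg (le_min (hφ _) (hφ _)) (le_min dist_nonneg zero_le_one)
  have habs := abs_nonneg (φ z.time - φ w.time)
  have hw' : SqueezedSpace.spatialPart φ z w + |φ z.time - φ w.time| + δ z.time w.time < ε := hw
  show δ z.time w.time < ε
  linarith

theorem continuous_pt (hsqz : IsSqueezedTopology X) :
    Continuous fun p : X × ℝ => SqueezedSpace.pt p.1 p.2 := by
  obtain ⟨δ, φ, hδ, hφ, -, -, -, hbasis⟩ := hsqz
  refine continuous_iff_continuousAt.2 fun ⟨x, s⟩ => (hbasis _).tendsto_right_iff.2 fun ε hε => ?_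
  have htime : Tendsto (fun p : X × ℝ => (p.2 : EReal)) (𝓝 (x, s)) (𝓝 (s : EReal)) :=
    (continuous_coe_real_ereal.comp continuous_snd).tendsto (x, s)
  have hφs := (hφ.tendsto s).comp htime
  have h1 : Tendsto (fun p : X × ℝ => min (φ s) (φ p.2) * min (dist x p.1) 1)
      (𝓝 (x, s)) (𝓝 (min (φ s) (φ s) * min (dist x x) 1)) :=
    (tendsto_const_nhds.min hφs).mul
      ((tendsto_const_nhds.dist (continuous_fst.tendsto (x, s))).min tendsto_const_nhds)
  have h2 : Tendsto (fun p : X × ℝ => |φ s - φ p.2|) (𝓝 (x, s)) (𝓝 |φ s - φ s|) :=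
    (tendsto_const_nhds.sub hφs).abs
  have h3 := (h1.add h2).add ((hδ.tendsto_self s).comp htime)
  simp only [dist_self, sub_self, abs_zero, add_zero, zero_le_one, min_eq_left, mul_zero] at h3
  exact h3.eventually_lt_const hε

/-- Without the spatial term, `sqzDist` from `z` is a function of time alone. This applies to the
two points at infinity. -/
theorem le_nhds_of_spatialPart_eq_zero (hsqz : IsSqueezedTopology X) {z : SqueezedSpace X}
    (hz : ∀ (φ : EReal → ℝ) w, SqueezedSpace.spatialPart φ z w = 0)
    {F : Filter (SqueezedSpace X)} (hF : Tendsto SqueezedSpace.time F (𝓝 z.time)) : F ≤ 𝓝 z := by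
  obtain ⟨δ, φ, hδ, hφ, -, -, -, hbasis⟩ := hsqz
  refine (hbasis z).ge_iff.2 fun ε hε => ?_
  have h2 : Tendsto (fun w : SqueezedSpace X => |φ z.time - φ w.time|) F
      (𝓝 |φ z.time - φ z.time|) :=
    (tendsto_const_nhds.sub ((hφ.tendsto _).comp hF)).abs
  have h3 := h2.add ((hδ.tendsto_self z.time).comp hF)
  simp only [sub_self, abs_zero, add_zero] at h3
  filter_upwards [h3.eventually_lt_const hε] with w hw
  simpa [SqueezedSpace.sqzDist, hz] using hw

theorem le_nhds_posInf (hsqz : IsSqueezedTopology X) {F : Filter (SqueezedSpace X)}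
    (hF : Tendsto SqueezedSpace.time F (𝓝 ⊤)) : F ≤ 𝓝 .posInf :=
  le_nhds_of_spatialPart_eq_zero hsqz (fun _ w => by cases w <;> rfl) hF

theorem le_nhds_negInf (hsqz : IsSqueezedTopology X) {F : Filter (SqueezedSpace X)}
    (hF : Tendsto SqueezedSpace.time F (𝓝 ⊥)) : F ≤ 𝓝 .negInf :=
  le_nhds_of_spatialPart_eq_zero hsqz (fun _ w => by cases w <;> rfl) hF

end Squeezed

/-! ### Segments -/

section Betweenness

variable {X : Type*}

theorem Betweenness.right_mem (B : Betweenness X) (x z : X) : z ∈ B.seg x z :=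
  B.seg_comm z x ▸ B.left_mem z x

theorem Betweenness.seg_self (B : Betweenness X) (x : X) : B.seg x x = {x} := by
  simpa using B.inter_eq x x x (B.left_mem x x)

/-- Antisymmetry of the order on a segment: `b` lies in `⟨a, y⟩ ∩ ⟨y, b⟩ = {y}`. -/
theorem Betweenness.eq_of_mem_seg (B : Betweenness X) {a b y : X} (hy : y ∈ B.seg a b)
    (hb : b ∈ B.seg a y) : b = y := by
  have h : b ∈ B.seg a y ∩ B.seg y b := ⟨hb, B.right_mem y b⟩
  rwa [B.inter_eq a y b hy] at h

theorem Betweenness.Compatible.isCompact_seg [MetricSpace X] {B : Betweenness X}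
    (hB : B.Compatible) (x z : X) : IsCompact (B.seg x z) :=
  hB.1 x z

/-- Segments whose endpoints converge to the same point converge to that point. -/
theorem Betweenness.Compatible.eventually_seg_subset [MetricSpace X] {B : Betweenness X}
    (hB : B.Compatible) {ι : Type*} {F : Filter ι} {u v : ι → X} {y : X}
    (hu : Tendsto u F (𝓝 y)) (hv : Tendsto v F (𝓝 y)) {U : Set X} (hU : U ∈ 𝓝 y) :
    ∀ᶠ i in F, B.seg (u i) (v i) ⊆ U := by
  obtain ⟨hc, hcont⟩ := hB
  obtain ⟨V, hVU, hV, hyV⟩ := mem_nhds_iff.1 hU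
  let W : Set (TopologicalSpace.NonemptyCompacts X) := {K | (K : Set X) ⊆ V}
  have hW : IsOpen W := by
    let := TopologicalSpace.vietoris X
    exact hV.powerset_vietoris.preimage TopologicalSpace.NonemptyCompacts.continuous_coe
  have := (hcont.tendsto (y, y)).comp (hu.prodMk_nhds hv)
  filter_upwards [this.eventually (hW.mem_nhds (show B.seg y y ⊆ V by simpa [B.seg_self]))]
    with i hi
  exact Subset.trans hi hVU

end Betweenness

/-! ### Cadlag functions -/

section Cadlag

variable {X : Type*} [MetricSpace X]

/-- A left limit at a point of `(a, u)` only sees values of `f` on `(a, u)`, and closed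
neighbourhoods of `y` retain limits. -/
theorem tendsto_leftLim_nhdsGT {α β : Type*} [LinearOrder α] [TopologicalSpace α] [OrderTopology α]
    [TopologicalSpace β] [T3Space β] {f : α → β} {a : α} {y : β} (h : Tendsto f (𝓝[>] a) (𝓝 y)) :
    Tendsto (Function.leftLim f) (𝓝[>] a) (𝓝 y) := by
  refine (closed_nhds_basis y).tendsto_right_iff.2 ?_
  rintro s ⟨hs, hsc⟩
  rcases eq_or_neBot (𝓝[>] a) with h' | h'
  · simp [h']
  obtain ⟨b, hb⟩ : (Ioi a).Nonempty := Filter.nonempty_of_mem (self_mem_nhdsWithin (a := a))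
  obtain ⟨u, hau, hu⟩ := (mem_nhdsGT_iff_exists_Ioo_subset' hb).1 (h hs)
  filter_upwards [Ioo_mem_nhdsGT hau] with c hc
  -- Without left neighbours, or without a left limit, `leftLim f c` is `f c` by default.
  rcases eq_or_neBot (𝓝[<] c) with h'c | h'c
  · simpa [h'c, leftLim_eq_of_eq_bot] using hu hc
  by_cases! h''c : ¬ ∃ y, Tendsto f (𝓝[<] c) (𝓝 y)
  · simpa [leftLim_eq_of_not_tendsto _ h''c] using hu hc
  apply hsc.mem_of_tendsto (tendsto_leftLim_of_tendsto h''c)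
  filter_upwards [Ioo_mem_nhdsLT_of_mem ⟨hc.1, hc.2.le⟩] with d hd using hu hd

variable {I : Set ℝ} [I.OrdConnected] {f : I → X}

theorem IsCadlag.tendsto_nhdsLT (hf : IsCadlag f) (t : I) :
    Tendsto f (𝓝[<] t) (𝓝 (Function.leftLim f t)) :=
  tendsto_leftLim_of_tendsto (hf t).2

theorem IsCadlag.tendsto_leftLim_nhdsLT (hf : IsCadlag f) (t : I) :
    Tendsto (Function.leftLim f) (𝓝[<] t) (𝓝 (Function.leftLim f t)) :=
  (continuousWithinAt_leftLim_Iic (hf.tendsto_nhdsLT t)).mono_left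
    (nhdsWithin_mono _ Iio_subset_Iic_self)

theorem IsCadlag.tendsto_leftLim_nhdsGT (hf : IsCadlag f) (t : I) :
    Tendsto (Function.leftLim f) (𝓝[>] t) (𝓝 (f t)) :=
  SkorohodPath.tendsto_leftLim_nhdsGT (hf t).1

/-- The jump size tends to `0` in every punctured neighbourhood, so the jumps larger than `1 / (k +
1)` form a discrete, hence countable, set. -/
theorem IsCadlag.countable_leftLim_ne (hf : IsCadlag f) :
    {t : I | Function.leftLim f t ≠ f t}.Countable := by
  let J : I → ℝ := fun t => dist (Function.leftLim f t) (f t)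
  have hJ : ∀ t, Tendsto J (𝓝[≠] t) (𝓝 0) := by
    intro t
    rw [← Iio_union_Ioi, nhdsWithin_union]
    refine Tendsto.sup ?_ ?_
    · simpa using (hf.tendsto_leftLim_nhdsLT t).dist (hf.tendsto_nhdsLT t)
    · simpa using (hf.tendsto_leftLim_nhdsGT t).dist (hf t).1
  have hA : ∀ k : ℕ, {t : I | 1 / ((k : ℝ) + 1) < J t}.Countable := by
    intro k
    have : DiscreteTopology {t : I | 1 / ((k : ℝ) + 1) < J t} := by
      refine discreteTopology_subtype_iff.2 fun t _ => ?_
      rw [← disjoint_iff, disjoint_principal_right]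
      filter_upwards [(hJ t).eventually_lt_const (Nat.one_div_pos_of_nat (n := k))] with s hs
      exact hs.le.not_gt
    exact countable_of_Lindelof_of_discrete
  refine (countable_iUnion hA).mono fun t ht => ?_
  obtain ⟨k, hk⟩ := exists_nat_one_div_lt (dist_pos.2 ht)
  exact mem_iUnion.2 ⟨k, hk⟩

theorem IsCadlag.exists_gt_leftLim_eq {f : Ici (0 : ℝ) → X} (hf : IsCadlag f) {T : ℝ}
    (hT : 0 ≤ T) :
    ∃ (t : ℝ) (ht : T < t),
      Function.leftLim f ⟨t, hT.trans ht.le⟩ = f ⟨t, hT.trans ht.le⟩ := by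
  obtain ⟨t, ht, hTt⟩ :=
    ((hf.countable_leftLim_ne.image Subtype.val).dense_compl ℝ).exists_gt T
  refine ⟨t, hTt, ?_⟩
  by_contra h
  exact ht ⟨⟨t, hT.trans hTt.le⟩, h, rfl⟩

end Cadlag

/-! ### Filled-in graphs -/

section Graph

variable {X : Type*} [MetricSpace X] {I : Set ℝ} {B : Betweenness X} {f : I → X}
  {z w : SqueezedSpace X}

theorem posInf_mem_filledGraph : .posInf ∈ filledGraph B f := by simp [filledGraph]

theorem negInf_mem_filledGraph : .negInf ∈ filledGraph B f := by simp [filledGraph]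

theorem pt_mem_filledGraph (t : I) : .pt (f t) t ∈ filledGraph B f :=
  .inl ⟨t, f t, B.right_mem _ _, rfl⟩

theorem leftLim_pt_mem_filledGraph (t : I) : .pt (Function.leftLim f t) t ∈ filledGraph B f :=
  .inl ⟨t, _, B.left_mem _ _, rfl⟩

theorem graphLE.time_le (h : graphLE B f z w) : z.time ≤ w.time := by
  rcases h with h | rfl | ⟨t, x, y, rfl, rfl, -⟩
  exacts [h.le, le_rfl, le_rfl]

theorem graphLE.eq_posInf (h : graphLE B f .posInf w) : .posInf = w := by
  rcases h with h | h | ⟨t, x, y, h, -⟩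
  exacts [(not_top_lt h).elim, h, nomatch h]

/-- Maximality of `(f t, t)` among the graph points up to time `t`, as `f t` is the last point of
its segment. Monotonicity of the modified correspondences rests on this. -/
theorem graphLE.eq_of_time_le {t : I} (h : graphLE B f (.pt (f t) t) w)
    (hw : w ∈ filledGraph B f) (hwt : w.time ≤ (t : ℝ)) : .pt (f t) t = w := by
  rcases h with h | h | ⟨s, x, y, h, rfl, hxy⟩
  · exact (h.not_ge hwt).elim
  · exact h
  · injection h with hx hs
    subst hx
    obtain rfl : t = s := Subtype.ext hs
    rcases hw with ⟨s, x, hx, h⟩ | h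
    · injection h with hy hs
      subst hy
      obtain rfl : t = s := Subtype.ext hs
      rw [B.eq_of_mem_seg hx hxy]
    · simp at h

/-- A point of the filled-in graph at a time at which the path does not jump. -/
theorem eq_pt_of_time_eq {t : I} (ht : Function.leftLim f t = f t) (hw : w ∈ filledGraph B f)
    (hwt : w.time = (t : ℝ)) : w = .pt (f t) t := by
  rcases hw with ⟨s, x, hx, rfl⟩ | rfl | rfl
  · obtain rfl : s = t := Subtype.ext (EReal.coe_eq_coe_iff.1 hwt)
    rw [ht, B.seg_self] at hx
    rw [mem_singleton_iff.1 hx]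
  · exact (EReal.bot_ne_coe _ hwt).elim
  · exact (EReal.top_ne_coe _ hwt).elim

theorem leftLim_restrictTo {f : Ici (0 : ℝ) → X} (hf : IsCadlag f) (t : ℝ) (s : Icc (0 : ℝ) t) :
    Function.leftLim (restrictTo f t) s = Function.leftLim f ⟨s, s.2.1⟩ := by
  obtain ⟨s, hs0, hst⟩ := s
  rcases hs0.eq_or_lt with rfl | hs
  -- Time `0` is the bottom of both domains, so both left limits default to the value there.
  · rw [leftLim_eq_of_isBot, leftLim_eq_of_isBot]
    · rfl
    · exact fun r => r.2
    · exact fun r => r.2.1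
  · have hne : (𝓝[<] (⟨s, hs0, hst⟩ : Icc (0 : ℝ) t)).NeBot := by
      have : DenselyOrdered (Icc (0 : ℝ) t) := inferInstance
      exact nhdsLT_neBot_of_exists_lt ⟨⟨0, le_rfl, hs0.trans hst⟩, hs⟩
    refine leftLim_eq_of_tendsto ((hf.tendsto_nhdsLT ⟨s, hs0⟩).comp ?_)
    refine tendsto_nhdsWithin_iff.2 ⟨?_, ?_⟩
    · refine Tendsto.mono_left ?_ nhdsWithin_le_nhds
      exact (Continuous.subtype_mk continuous_subtype_val _).tendsto _
    · exact self_mem_nhdsWithin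

theorem mem_filledGraph_restrictTo {f : Ici (0 : ℝ) → X} (hf : IsCadlag f) {t : ℝ} :
    z ∈ filledGraph B (restrictTo f t) ↔
      z ∈ filledGraph B f ∧ (z.time ≤ t ∨ z = .posInf) := by
  constructor
  · rintro (⟨s, x, hx, rfl⟩ | rfl | rfl)
    · rw [leftLim_restrictTo hf] at hx
      exact ⟨.inl ⟨⟨s, s.2.1⟩, x, hx, rfl⟩, .inl (EReal.coe_le_coe s.2.2)⟩
    · exact ⟨negInf_mem_filledGraph, .inl bot_le⟩
    · exact ⟨posInf_mem_filledGraph, .inr rfl⟩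
  · rintro ⟨⟨s, x, hx, rfl⟩ | rfl | rfl, h⟩
    · have hs : (s : ℝ) ≤ t := EReal.coe_le_coe_iff.1 (h.resolve_right (by simp))
      refine .inl ⟨⟨s, s.2, hs⟩, x, ?_, rfl⟩
      rw [leftLim_restrictTo hf]
      exact hx
    · exact negInf_mem_filledGraph
    · exact posInf_mem_filledGraph

theorem graphLE_restrictTo_iff {f : Ici (0 : ℝ) → X} (hf : IsCadlag f) {t : ℝ}
    (hz : z ∈ filledGraph B (restrictTo f t)) :
    graphLE B (restrictTo f t) z w ↔ graphLE B f z w := by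
  refine or_congr Iff.rfl (or_congr Iff.rfl ⟨?_, ?_⟩)
  · rintro ⟨s, x, y, rfl, rfl, h⟩
    rw [leftLim_restrictTo hf] at h
    exact ⟨⟨s, s.2.1⟩, x, y, rfl, rfl, h⟩
  · rintro ⟨s, x, y, rfl, rfl, h⟩
    have hs : (s : ℝ) ≤ t :=
      EReal.coe_le_coe_iff.1 (((mem_filledGraph_restrictTo hf).1 hz).2.resolve_right (by simp))
    refine ⟨⟨s, s.2, hs⟩, x, y, rfl, rfl, ?_⟩
    rw [leftLim_restrictTo hf]
    exact h

end Graph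

/-! ### Compactness of filled-in graphs and its consequences -/

section Compactness

variable {X : Type*} [MetricSpace X] {B : Betweenness X}

/-- If the segments `⟨u s, f s⟩` shrink to `y` as `s` tends to `t` within `S`, then `(y, t)` is the
only limit of points of the filled-in graph with times in `S` tending to `t`. -/
theorem le_nhds_pt_of_tendsto [TopologicalSpace (SqueezedSpace X)]
    (hB : B.Compatible) (hsqz : IsSqueezedTopology X) {f : Ici (0 : ℝ) → X} {t : Ici (0 : ℝ)}
    {S : Set (Ici (0 : ℝ))} {y : X} (hl : Tendsto (Function.leftLim f) (𝓝[S] t) (𝓝 y))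
    (hr : Tendsto f (𝓝[S] t) (𝓝 y)) {F : Filter (SqueezedSpace X)}
    (hF : Tendsto SqueezedSpace.time F (𝓝 ((t : ℝ) : EReal)))
    (hFG : ∀ᶠ z in F, z ∈ filledGraph B f)
    (hFS : ∀ᶠ z in F, ∀ s : Ici (0 : ℝ), z.time = ((s : ℝ) : EReal) → s ∈ S) : F ≤ 𝓝 (.pt y t) := by
  intro U hU
  have hU' := (continuous_pt hsqz).tendsto (y, (t : ℝ)) hU
  rw [mem_map, nhds_prod_eq, mem_prod_iff] at hU'
  obtain ⟨V, hV, W, hW, hVW⟩ := hU'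
  have hev := hB.eventually_seg_subset hl hr hV
  have hW' : ∀ᶠ s : Ici (0 : ℝ) in 𝓝[S] t, (s : ℝ) ∈ W :=
    nhdsWithin_le_nhds (continuous_subtype_val.tendsto t hW)
  have := eventually_nhdsWithin_iff.1 (hev.and hW')
  obtain ⟨ε, hε, hball⟩ := Metric.eventually_nhds_iff.1 this
  have hI : Ioo (((t - ε : ℝ)) : EReal) ((t + ε : ℝ) : EReal) ∈ 𝓝 ((t : ℝ) : EReal) :=
    Ioo_mem_nhds (EReal.coe_lt_coe (by linarith)) (EReal.coe_lt_coe (by linarith))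
  filter_upwards [hF hI, hFG, hFS] with z hz hzG hzS
  rcases hzG with ⟨s, x, hx, rfl⟩ | rfl | rfl
  · have h1 : (t : ℝ) - ε < s := EReal.coe_lt_coe_iff.1 hz.1
    have h2 : (s : ℝ) < t + ε := EReal.coe_lt_coe_iff.1 hz.2
    have hd : dist s t < ε := by
      rw [Subtype.dist_eq, Real.dist_eq, abs_lt]
      constructor <;> linarith
    obtain ⟨hs1, hs2⟩ := hball hd (hzS s rfl)
    exact hVW (mk_mem_prod (hs1 hx) hs2)
  · exact (not_lt_bot hz.1).elim
  · exact (not_top_lt hz.2).elim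

/-- Along an ultrafilter the times converge in the compact space `EReal`. At a finite limit `r`, the
points lie eventually before, at or after `r`, and converge respectively to the left limit, within
the compact segment at `r`, or to the value. -/
theorem isCompact_filledGraph [TopologicalSpace (SqueezedSpace X)]
    (hB : B.Compatible) (hsqz : IsSqueezedTopology X) {f : Ici (0 : ℝ) → X} (hf : IsCadlag f) :
    IsCompact (filledGraph B f) := by
  refine isCompact_iff_ultrafilter_le_nhds.2 fun F hF => ?_
  have hFG : ∀ᶠ z in (F : Filter (SqueezedSpace X)), z ∈ filledGraph B f := le_principal_iff.1 hF
  have hτ : Tendsto SqueezedSpace.time (F : Filter (SqueezedSpace X)) (𝓝 (F.map SqueezedSpace.time).lim) :=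
    (F.map SqueezedSpace.time).le_nhds_lim
  generalize (F.map SqueezedSpace.time).lim = τ at hτ
  induction τ with
  | bot => exact ⟨_, negInf_mem_filledGraph, le_nhds_negInf hsqz hτ⟩
  | top => exact ⟨_, posInf_mem_filledGraph, le_nhds_posInf hsqz hτ⟩
  | coe r =>
    -- Near a finite limit `negInf` is excluded, and all other graph points have nonnegative times.
    have hr : 0 ≤ r := by
      refine EReal.coe_le_coe_iff.1 (ge_of_tendsto hτ ?_)
      filter_upwards [hτ.eventually_ne (EReal.coe_ne_bot r), hFG] with z hz hzG
      rcases hzG with ⟨s, x, hx, rfl⟩ | rfl | rfl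
      · exact EReal.coe_le_coe s.2
      · exact (hz rfl).elim
      · exact le_top
    let t : Ici (0 : ℝ) := ⟨r, hr⟩
    have htri : ∀ᶠ z in (F : Filter (SqueezedSpace X)),
        z.time < (r : EReal) ∨ z.time = (r : EReal) ∨ (r : EReal) < z.time := .of_forall fun z => lt_trichotomy _ _
    rw [Ultrafilter.eventually_or, Ultrafilter.eventually_or] at htri
    rcases htri with h | h | h
    · refine ⟨.pt (Function.leftLim f t) r, leftLim_pt_mem_filledGraph t,
        le_nhds_pt_of_tendsto hB hsqz (t := t) (S := Iio t) (hf.tendsto_leftLim_nhdsLT t)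
          (hf.tendsto_nhdsLT t) hτ hFG ?_⟩
      filter_upwards [h] with z hz s hs
      exact EReal.coe_lt_coe_iff.1 (hs ▸ hz)
    · have hC : IsCompact ((fun x : X => SqueezedSpace.pt x r) ''
          B.seg (Function.leftLim f t) (f t)) :=
        (hB.isCompact_seg _ _).image
          ((continuous_pt hsqz).comp (continuous_id.prodMk continuous_const))
      obtain ⟨z, ⟨x, hx, rfl⟩, hz⟩ := isCompact_iff_ultrafilter_le_nhds.1 hC F (by
        rw [le_principal_iff]
        filter_upwards [h, hFG] with z hz hzG
        rcases hzG with ⟨s, x, hx, rfl⟩ | rfl | rfl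
        · obtain rfl : s = t := Subtype.ext (EReal.coe_eq_coe_iff.1 hz)
          exact ⟨x, hx, rfl⟩
        · exact (EReal.bot_ne_coe _ hz).elim
        · exact (EReal.top_ne_coe _ hz).elim)
      exact ⟨_, .inl ⟨t, x, hx, rfl⟩, hz⟩
    · refine ⟨.pt (f t) r, pt_mem_filledGraph t,
        le_nhds_pt_of_tendsto hB hsqz (t := t) (S := Ioi t) (hf.tendsto_leftLim_nhdsGT t)
          (hf t).1 hτ hFG ?_⟩
      filter_upwards [h] with z hz s hs
      exact EReal.coe_lt_coe_iff.1 (hs ▸ hz)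

variable [MetricSpace (SqueezedSpace X)]

/-- Two close points, one on the filled-in graph of `f`, whose times lie on different sides of a
continuity time `t` of `f`, are close to `(f t, t)`. -/
theorem exists_edist_pt_lt_of_time_between (hB : B.Compatible) (hsqz : IsSqueezedTopology X)
    {f : Ici (0 : ℝ) → X} (hf : IsCadlag f) {t : Ici (0 : ℝ)} (ht : Function.leftLim f t = f t)
    {ε : ℝ≥0∞} (hε : 0 < ε) :
    ∃ η > 0, ∀ z, ∀ w ∈ filledGraph B f, edist z w < η →
      (z.time ≤ (t : ℝ) ∧ (t : ℝ) ≤ w.time ∨ w.time ≤ (t : ℝ) ∧ (t : ℝ) ≤ z.time) →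
        edist w (.pt (f t) t) < ε := by
  have hK : IsCompact (filledGraph B f \ Metric.eball (.pt (f t) t) ε) :=
    (isCompact_filledGraph hB hsqz hf).diff Metric.isOpen_eball
  have htime := continuous_time hsqz
  have hle : IsClosed {z : SqueezedSpace X | z.time ≤ (t : ℝ)} :=
    isClosed_le htime continuous_const
  have hge : IsClosed {z : SqueezedSpace X | (t : ℝ) ≤ z.time} :=
    isClosed_le continuous_const htime
  have hdisj : ∀ w ∈ filledGraph B f \ Metric.eball (.pt (f t) t) ε, w.time ≠ (t : ℝ) := by
    rintro w ⟨hw, hwb⟩ hwt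
    rw [eq_pt_of_time_eq ht hw hwt] at hwb
    exact hwb (Metric.mem_eball_self hε)
  -- Outside the ball the graph has no point at time `t`, so its compact part on each side of `t`
  -- has positive distance to the closed half of the space on the other side.
  obtain ⟨r₁, hr₁, h₁⟩ := Metric.exists_pos_forall_lt_edist (hK.inter_right hge) hle
    (disjoint_left.2 fun w hw hw' => hdisj w hw.1 (le_antisymm hw' hw.2))
  obtain ⟨r₂, hr₂, h₂⟩ := Metric.exists_pos_forall_lt_edist (hK.inter_right hle) hge
    (disjoint_left.2 fun w hw hw' => hdisj w hw.1 (le_antisymm hw.2 hw'))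
  refine ⟨min r₁ r₂, lt_min (by exact_mod_cast hr₁) (by exact_mod_cast hr₂),
    fun z w hw hzw hside => ?_⟩
  by_contra hwb
  have hwK : w ∈ filledGraph B f \ Metric.eball (.pt (f t) t) ε := ⟨hw, hwb⟩
  rw [edist_comm] at hzw
  rcases hside with ⟨hz, hw'⟩ | ⟨hw', hz⟩
  · exact (h₁ w ⟨hwK, hw'⟩ z hz).not_ge (hzw.le.trans (min_le_left _ _))
  · exact (h₂ w ⟨hwK, hw'⟩ z hz).not_ge (hzw.le.trans (min_le_right _ _))

theorem exists_time_gt_of_edist_posInf_lt (hsqz : IsSqueezedTopology X) (t : ℝ) :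
    ∃ η > 0, ∀ z : SqueezedSpace X, edist z .posInf < η → t < z.time := by
  have : {z : SqueezedSpace X | (t : EReal) < z.time} ∈ 𝓝 .posInf :=
    (isOpen_lt continuous_const (continuous_time hsqz)).mem_nhds (EReal.coe_lt_top t)
  exact EMetric.mem_nhds_iff.1 this

theorem exists_edist_posInf_lt_of_time_ge (hsqz : IsSqueezedTopology X) {ε : ℝ≥0∞} (hε : 0 < ε) :
    ∃ T : ℝ, 0 ≤ T ∧ ∀ z : SqueezedSpace X, T ≤ z.time → edist z .posInf < ε := by
  have h := le_nhds_posInf hsqz (F := comap SqueezedSpace.time (𝓝 ⊤)) tendsto_comap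
    (Metric.eball_mem_nhds _ hε)
  obtain ⟨U, hU, hUε⟩ := h
  obtain ⟨T, hT⟩ := EReal.mem_nhds_top_iff.1 hU
  -- The added `1` makes the time exceed the old threshold strictly.
  refine ⟨max T 0 + 1, by positivity, fun z hz => hUε (hT ?_)⟩
  refine lt_of_lt_of_le (EReal.coe_lt_coe ?_) hz
  linarith [le_max_left T 0]

end Compactness

/-! ### Transfer of correspondences -/

section Correspondence

variable {X : Type*} [MetricSpace X] [MetricSpace (SqueezedSpace X)] {B : Betweenness X}

theorem exists_correspondence_restrictTo {f g : Ici (0 : ℝ) → X} (hf : IsCadlag f)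
    (hg : IsCadlag g) {t : Ici (0 : ℝ)} {ε η : ℝ≥0∞} (hηε : η ≤ ε)
    (hη : ∀ z, ∀ w ∈ filledGraph B f, edist z w < η →
      (z.time ≤ (t : ℝ) ∧ (t : ℝ) ≤ w.time ∨ w.time ≤ (t : ℝ) ∧ (t : ℝ) ≤ z.time) →
        edist w (.pt (f t) t) < ε)
    {R : Set (SqueezedSpace X × SqueezedSpace X)}
    (hR : IsCorrespondence (filledGraph B g) (filledGraph B f) R)
    (hRη : ∀ p ∈ R, edist p.1 p.2 < η) :
    ∃ R' : Set (SqueezedSpace X × SqueezedSpace X),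
      IsCorrespondence (filledGraph B (restrictTo g t)) (filledGraph B (restrictTo f t)) R' ∧
      (IsMonotoneCorr (graphLE B g) (graphLE B f) R →
        IsMonotoneCorr (graphLE B (restrictTo g t)) (graphLE B (restrictTo f t)) R') ∧
      ∀ p ∈ R', edist p.1 p.2 ≤ ε + ε + ε := by
  obtain ⟨hRsub, hR1, hR2⟩ := hR
  have mg : ∀ {z}, z ∈ filledGraph B g → z.time ≤ (t : ℝ) → z ∈ filledGraph B (restrictTo g t) :=
    fun h h' => (mem_filledGraph_restrictTo hg).2 ⟨h, .inl h'⟩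
  have mf : ∀ {z}, z ∈ filledGraph B f → z.time ≤ (t : ℝ) → z ∈ filledGraph B (restrictTo f t) :=
    fun h h' => (mem_filledGraph_restrictTo hf).2 ⟨h, .inl h'⟩
  -- Membership in the last two families remembers the discarded partner after `t`, which is needed
  -- for both closeness and monotonicity.
  let R' : Set (SqueezedSpace X × SqueezedSpace X) := {p |
    (p ∈ R ∧ p.1.time ≤ (t : ℝ) ∧ p.2.time ≤ (t : ℝ)) ∨ p = (.posInf, .posInf) ∨
    (p.1 ∈ filledGraph B g ∧ p.1.time ≤ (t : ℝ) ∧ p.2 = .pt (f t) t ∧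
      ∃ w, (p.1, w) ∈ R ∧ (t : ℝ) < w.time) ∨
    (p.1 = .pt (g t) t ∧ p.2 ∈ filledGraph B f ∧ p.2.time ≤ (t : ℝ) ∧
      ∃ z, (z, p.2) ∈ R ∧ (t : ℝ) < z.time)}
  have hsub : R' ⊆ filledGraph B (restrictTo g t) ×ˢ filledGraph B (restrictTo f t) := by
    rintro ⟨z, w⟩ (⟨hp, hz, hw⟩ | hp | ⟨hz, hzt, rfl, -⟩ | ⟨rfl, hw, hwt, -⟩)
    · exact ⟨mg (hRsub hp).1 hz, mf (hRsub hp).2 hw⟩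
    · cases hp
      exact ⟨posInf_mem_filledGraph, posInf_mem_filledGraph⟩
    · exact ⟨mg hz hzt, mf (pt_mem_filledGraph t) le_rfl⟩
    · exact ⟨mg (pt_mem_filledGraph t) le_rfl, mf hw hwt⟩
  refine ⟨R', ⟨hsub, fun z hz => ?_, fun w hw => ?_⟩, fun hmon => ?_, ?_⟩
  · obtain ⟨hzG, hzt | rfl⟩ := (mem_filledGraph_restrictTo hg).1 hz
    · obtain ⟨w, hw, hzw⟩ := hR1 z hzG
      rcases le_or_gt w.time ((t : ℝ) : EReal) with hwt | hwt
      · exact ⟨w, mf hw hwt, .inl ⟨hzw, hzt, hwt⟩⟩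
      · exact ⟨_, mf (pt_mem_filledGraph t) le_rfl, .inr (.inr (.inl ⟨hzG, hzt, rfl, w, hzw, hwt⟩))⟩
    · exact ⟨_, posInf_mem_filledGraph, .inr (.inl rfl)⟩
  · obtain ⟨hwG, hwt | rfl⟩ := (mem_filledGraph_restrictTo hf).1 hw
    · obtain ⟨z, hz, hzw⟩ := hR2 w hwG
      rcases le_or_gt z.time ((t : ℝ) : EReal) with hzt | hzt
      · exact ⟨z, mg hz hzt, .inl ⟨hzw, hzt, hwt⟩⟩
      · exact ⟨_, mg (pt_mem_filledGraph t) le_rfl,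
          .inr (.inr (.inr ⟨rfl, hwG, hwt, z, hzw, hzt⟩))⟩
    · exact ⟨_, posInf_mem_filledGraph, .inr (.inl rfl)⟩
  -- A violation in `R'` either places an endpoint strictly below a point up to time `t`, or places
  -- `posInf` strictly below something, or compares a point with itself, or becomes a violation in
  -- `R` once discarded partners are put back.
  · rintro ⟨⟨z, w⟩, hp, ⟨z', w'⟩, hp', ⟨hzz, hzne⟩, hww, hwne⟩
    rw [graphLE_restrictTo_iff hg (hsub hp).1] at hzz
    rw [graphLE_restrictTo_iff hf (hsub hp').2] at hww
    have lt_of_time : ∀ {h : Ici (0 : ℝ) → X} {a b : SqueezedSpace X}, a.time ≤ (t : ℝ) →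
        (t : ℝ) < b.time → graphLE B h a b ∧ a ≠ b := fun ha hb =>
      ⟨.inl (ha.trans_lt hb), fun hab => (ha.trans_lt hb).ne (congrArg _ hab)⟩
    simp only at hzz hzne hww hwne
    rcases hp with ⟨hp, hzt, hwt⟩ | hp | ⟨hzG, hzt, rfl, v, hv, hvt⟩ | ⟨rfl, hwG, hwt, v, hv, hvt⟩ <;>
      rcases hp' with ⟨hp', hzt', hwt'⟩ | hp' | ⟨hzG', hzt', rfl, v', hv', hvt'⟩ |
        ⟨rfl, hwG', hwt', v', hv', hvt'⟩
    · exact hmon ⟨_, hp, _, hp', ⟨hzz, hzne⟩, hww, hwne⟩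
    · cases hp'; exact hwne hww.eq_posInf
    · exact hwne (hww.eq_of_time_le (hRsub hp).2 hwt)
    · exact hmon ⟨_, hp, _, hv', lt_of_time hzt hvt', hww, hwne⟩
    · cases hp; exact hzne hzz.eq_posInf
    · cases hp; exact hzne hzz.eq_posInf
    · cases hp; exact hzne hzz.eq_posInf
    · cases hp; exact hzne hzz.eq_posInf
    · exact hmon ⟨_, hv, _, hp', ⟨hzz, hzne⟩, lt_of_time hwt' hvt⟩
    · cases hp'; exact hwne hww.eq_posInf
    · exact hwne rfl
    · exact hmon ⟨_, hv, _, hv', lt_of_time hzt hvt', lt_of_time hwt' hvt⟩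
    · exact hzne (hzz.eq_of_time_le (hRsub hp').1 hzt')
    · cases hp'; exact hwne hww.eq_posInf
    · exact hzne (hzz.eq_of_time_le hzG' hzt')
    · exact hzne rfl
  · rintro ⟨z, w⟩ (⟨hp, -⟩ | hp | ⟨hz, hzt, hw, v, hv, hvt⟩ | ⟨hz, hw, hwt, v, hv, hvt⟩)
    · exact ((hRη _ hp).le.trans hηε).trans (le_add_left le_rfl)
    · cases hp
      simp
    · simp only at hw hz hzt hv
      subst hw
      calc edist z (.pt (f t) t) ≤ edist z v + edist v (.pt (f t) t) := edist_triangle _ _ _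
        _ ≤ ε + ε := add_le_add ((hRη _ hv).le.trans hηε)
            (hη z v (hRsub hv).2 (hRη _ hv) (.inl ⟨hzt, hvt.le⟩)).le
        _ ≤ ε + ε + ε := le_add_right le_rfl
    · simp only at hw hz hwt hv
      subst hz
      -- As `(g t, t)` sits exactly at time `t`, it and its partner `u` straddle `t` whatever the
      -- time of `u`; hence `u` is near `(f t, t)`, with no continuity of `g` at `t`.
      obtain ⟨u, hu, hqu⟩ := hR1 _ (pt_mem_filledGraph t)
      have hup : edist u (.pt (f t) t) < ε := by
        refine hη _ u hu (hRη _ hqu) ?_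
        rcases le_total u.time ((t : ℝ) : EReal) with h | h
        exacts [.inr ⟨h, le_rfl⟩, .inl ⟨le_rfl, h⟩]
      calc edist (.pt (g t) t) w
          ≤ edist (.pt (g t) t) u + edist u (.pt (f t) t) + edist (.pt (f t) t) w :=
            edist_triangle4 _ _ _ _
        _ ≤ ε + ε + ε := by
          refine add_le_add (add_le_add ((hRη _ hqu).le.trans hηε) hup.le) ?_
          rw [edist_comm]
          exact (hη v w hw (hRη _ hv) (.inr ⟨hwt, hvt.le⟩)).le

theorem exists_correspondence_of_restrictTo {f g : Ici (0 : ℝ) → X} (hf : IsCadlag f)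
    (hg : IsCadlag g) {t : Ici (0 : ℝ)} {ε η : ℝ≥0∞} (hηε : η ≤ ε)
    (hε : ∀ z : SqueezedSpace X, (t : ℝ) ≤ z.time → edist z .posInf < ε)
    (hη : ∀ z : SqueezedSpace X, edist z .posInf < η → (t : ℝ) < z.time)
    {R : Set (SqueezedSpace X × SqueezedSpace X)}
    (hR : IsCorrespondence (filledGraph B (restrictTo g t)) (filledGraph B (restrictTo f t)) R)
    (hRη : ∀ p ∈ R, edist p.1 p.2 < η) :
    ∃ R' : Set (SqueezedSpace X × SqueezedSpace X),
      IsCorrespondence (filledGraph B g) (filledGraph B f) R' ∧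
      (IsMonotoneCorr (graphLE B (restrictTo g t)) (graphLE B (restrictTo f t)) R →
        IsMonotoneCorr (graphLE B g) (graphLE B f) R') ∧
      ∀ p ∈ R', edist p.1 p.2 ≤ ε + ε := by
  obtain ⟨hRsub, hR1, hR2⟩ := hR
  -- After `t` the correspondence is a staircase: the graph of `g` is run through against `(f t,
  -- t)`, then that of `f` against `posInf`. This is monotone whatever the paths do there.
  let R' : Set (SqueezedSpace X × SqueezedSpace X) := {p |
    (p ∈ R ∧ p.1.time ≤ (t : ℝ) ∧ p.2.time ≤ (t : ℝ)) ∨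
    (p.1 ∈ filledGraph B g ∧ (t : ℝ) < p.1.time ∧ p.2 = .pt (f t) t) ∨
    (p.1 = .posInf ∧ p.2 ∈ filledGraph B f ∧ (t : ℝ) < p.2.time)}
  have hsub : R' ⊆ filledGraph B g ×ˢ filledGraph B f := by
    rintro ⟨z, w⟩ (⟨hp, -⟩ | ⟨hz, -, rfl⟩ | ⟨rfl, hw, -⟩)
    · exact ⟨((mem_filledGraph_restrictTo hg).1 (hRsub hp).1).1,
        ((mem_filledGraph_restrictTo hf).1 (hRsub hp).2).1⟩
    · exact ⟨hz, pt_mem_filledGraph t⟩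
    · exact ⟨posInf_mem_filledGraph, hw⟩
  refine ⟨R', ⟨hsub, fun z hz => ?_, fun w hw => ?_⟩, fun hmon => ?_, ?_⟩
  · rcases le_or_gt z.time ((t : ℝ) : EReal) with hzt | hzt
    · obtain ⟨w, hw, hzw⟩ := hR1 z ((mem_filledGraph_restrictTo hg).2 ⟨hz, .inl hzt⟩)
      obtain ⟨hwG, hwt | rfl⟩ := (mem_filledGraph_restrictTo hf).1 hw
      · exact ⟨w, hwG, .inl ⟨hzw, hzt, hwt⟩⟩
      -- The choice of `η` forbids `R` from pairing a point up to time `t` with `posInf`, so the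
      -- kept pairs cover everything up to `t`.
      · exact ((hη z (hRη _ hzw)).not_ge hzt).elim
    · exact ⟨_, pt_mem_filledGraph t, .inr (.inl ⟨hz, hzt, rfl⟩)⟩
  · rcases le_or_gt w.time ((t : ℝ) : EReal) with hwt | hwt
    · obtain ⟨z, hz, hzw⟩ := hR2 w ((mem_filledGraph_restrictTo hf).2 ⟨hw, .inl hwt⟩)
      obtain ⟨hzG, hzt | rfl⟩ := (mem_filledGraph_restrictTo hg).1 hz
      · exact ⟨z, hzG, .inl ⟨hzw, hzt, hwt⟩⟩
      · have := hRη _ hzw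
        rw [edist_comm] at this
        exact ((hη w this).not_ge hwt).elim
    · exact ⟨_, posInf_mem_filledGraph, .inr (.inr ⟨rfl, hw, hwt⟩)⟩
  · rintro ⟨⟨z, w⟩, hp, ⟨z', w'⟩, hp', ⟨hzz, hzne⟩, hww, hwne⟩
    simp only at hzz hzne hww hwne
    have hw' := (hsub hp').2
    have hw := (hsub hp).2
    rcases hp with ⟨hp, hzt, hwt⟩ | ⟨hzG, hzt, rfl⟩ | ⟨rfl, hwG, hwt⟩
    · rcases hp' with ⟨hp', hzt', hwt'⟩ | ⟨hzG', hzt', rfl⟩ | ⟨rfl, hwG', hwt'⟩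
      · exact hmon ⟨_, hp, _, hp', ⟨(graphLE_restrictTo_iff hg (hRsub hp).1).2 hzz, hzne⟩,
          (graphLE_restrictTo_iff hf (hRsub hp').2).2 hww, hwne⟩
      · exact hwne (hww.eq_of_time_le hw hwt)
      · exact (hwt'.trans_le (hww.time_le.trans hwt)).false
    · rcases hp' with ⟨hp', hzt', hwt'⟩ | ⟨hzG', hzt', rfl⟩ | ⟨rfl, hwG', hwt'⟩
      · exact (hzt.trans_le (hzz.time_le.trans hzt')).false
      · exact hwne rfl
      · exact (hwt'.trans_le hww.time_le).false
    · exact hzne hzz.eq_posInf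
  · rintro ⟨z, w⟩ (⟨hp, -⟩ | ⟨hz, hzt, hw⟩ | ⟨hz, hw, hwt⟩)
    · exact ((hRη _ hp).le.trans hηε).trans (le_add_left le_rfl)
    · simp only at hw hz hzt
      subst hw
      calc edist z (.pt (f t) t)
          ≤ edist z SqueezedSpace.posInf + edist (SqueezedSpace.pt (f t) t) .posInf := edist_triangle_right _ _ _
        _ ≤ ε + ε := add_le_add (hε z hzt.le).le (hε _ le_rfl).le
    · simp only at hw hz hwt
      subst hz
      rw [edist_comm]
      exact (hε w hwt.le).le.trans (le_add_left le_rfl)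

/-! ### Distances in terms of correspondences -/

variable {ε : ℝ≥0∞}

theorem exists_correspondence_of_hausdorffEDist_lt {α : Type*} [PseudoEMetricSpace α]
    {K₁ K₂ : Set α} (h : Metric.hausdorffEDist K₁ K₂ < ε) :
    ∃ R : Set (α × α), IsCorrespondence K₁ K₂ R ∧ ∀ p ∈ R, edist p.1 p.2 < ε := by
  refine ⟨{p ∈ K₁ ×ˢ K₂ | edist p.1 p.2 < ε}, ⟨sep_subset _ _, fun x hx => ?_, fun y hy => ?_⟩,
    fun p hp => hp.2⟩
  · obtain ⟨y, hy, hxy⟩ := Metric.exists_edist_lt_of_hausdorffEDist_lt hx h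
    exact ⟨y, hy, ⟨hx, hy⟩, hxy⟩
  · rw [Metric.hausdorffEDist_comm] at h
    obtain ⟨x, hx, hxy⟩ := Metric.exists_edist_lt_of_hausdorffEDist_lt hy h
    exact ⟨x, hx, ⟨hx, hy⟩, by rwa [edist_comm] at hxy⟩

theorem IsCorrespondence.hausdorffEDist_le {α : Type*} [PseudoEMetricSpace α]
    {K₁ K₂ : Set α} {R : Set (α × α)} (hR : IsCorrespondence K₁ K₂ R)
    (h : ∀ p ∈ R, edist p.1 p.2 ≤ ε) : Metric.hausdorffEDist K₁ K₂ ≤ ε := by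
  refine Metric.hausdorffEDist_le_of_mem_edist (fun x hx => ?_) fun y hy => ?_
  · obtain ⟨y, hy, hxy⟩ := hR.2.1 x hx
    exact ⟨y, hy, h _ hxy⟩
  · obtain ⟨x, hx, hxy⟩ := hR.2.2 y hy
    exact ⟨x, hx, by rw [edist_comm]; exact h _ hxy⟩

theorem exists_correspondence_of_orderedHausdorffEDist_lt {α : Type*} [PseudoEMetricSpace α]
    {K₁ K₂ : Set α} {le₁ le₂ : α → α → Prop} (h : orderedHausdorffEDist K₁ le₁ K₂ le₂ < ε) :
    ∃ R : Set (α × α), (IsCorrespondence K₁ K₂ R ∧ IsMonotoneCorr le₁ le₂ R) ∧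
      ∀ p ∈ R, edist p.1 p.2 < ε := by
  simp only [orderedHausdorffEDist, iInf_lt_iff] at h
  obtain ⟨R, hR, h⟩ := h
  exact ⟨R, hR, fun p hp => (le_iSup₂ (f := fun p _ => edist p.1 p.2) p hp).trans_lt h⟩

theorem IsCorrespondence.orderedHausdorffEDist_le {α : Type*} [PseudoEMetricSpace α]
    {K₁ K₂ : Set α} {le₁ le₂ : α → α → Prop} {R : Set (α × α)} (hR : IsCorrespondence K₁ K₂ R)
    (hmon : IsMonotoneCorr le₁ le₂ R) (h : ∀ p ∈ R, edist p.1 p.2 ≤ ε) :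
    orderedHausdorffEDist K₁ le₁ K₂ le₂ ≤ ε :=
  (iInf₂_le R ⟨hR, hmon⟩).trans (iSup₂_le h)

end Correspondence

end SkorohodPath

/-! ### The two equivalences -/

open SkorohodPath in
theorem lemma3 {X : Type*} [MetricSpace X] (B : Betweenness X) (hB : B.Compatible)
    [MetricSpace (SqueezedSpace X)] (hsqz : IsSqueezedTopology X)
    (fn : ℕ → CadlagSpace (Ici (0 : ℝ)) X) (f : CadlagSpace (Ici (0 : ℝ)) X) :
    (Tendsto (fun n => dH B (fn n).toFun f.toFun) atTop (𝓝 0) ↔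
      ∀ (t : ℝ) (ht : 0 < t),
        Function.leftLim f.toFun ⟨t, ht.le⟩ = f.toFun ⟨t, ht.le⟩ →
          Tendsto (fun n => dH B (restrictTo (fn n).toFun t) (restrictTo f.toFun t))
            atTop (𝓝 0)) ∧
    (Tendsto (fun n => dTot B (fn n).toFun f.toFun) atTop (𝓝 0) ↔
      ∀ (t : ℝ) (ht : 0 < t),
        Function.leftLim f.toFun ⟨t, ht.le⟩ = f.toFun ⟨t, ht.le⟩ →
          Tendsto (fun n => dTot B (restrictTo (fn n).toFun t) (restrictTo f.toFun t))
            atTop (𝓝 0)) := by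
  have restrict : ∀ (t : ℝ) (ht : 0 < t),
      Function.leftLim f.toFun ⟨t, ht.le⟩ = f.toFun ⟨t, ht.le⟩ → ∀ ε : ℝ≥0∞, 0 < ε →
      ∃ η > 0, η ≤ ε / 3 ∧ ∀ (z : SqueezedSpace X), ∀ w ∈ filledGraph B f.toFun, edist z w < η →
        (z.time ≤ t ∧ t ≤ w.time ∨ w.time ≤ t ∧ t ≤ z.time) →
          edist w (.pt (f.toFun ⟨t, ht.le⟩) t) < ε / 3 := by
    intro t ht htc ε hε
    have hε3 : 0 < ε / 3 := ENNReal.div_pos hε.ne' (by simp)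
    obtain ⟨η, hη, h⟩ := exists_edist_pt_lt_of_time_between hB hsqz f.cadlag htc hε3
    exact ⟨min η (ε / 3), lt_min hη hε3, min_le_right _ _,
      fun z w hw hzw => h z w hw (hzw.trans_le (min_le_left _ _))⟩
  -- The cutoff `t` depends only on `ε` and `f`, and `η` is chosen after `t`; convergence at this
  -- single `t` then suffices for the given `ε`.
  have extend : ∀ ε : ℝ≥0∞, 0 < ε → ∃ (t : ℝ) (ht : 0 < t),
      Function.leftLim f.toFun ⟨t, ht.le⟩ = f.toFun ⟨t, ht.le⟩ ∧
      (∀ z : SqueezedSpace X, t ≤ z.time → edist z .posInf < ε / 2) ∧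
      ∃ η > 0, η ≤ ε / 2 ∧ ∀ z : SqueezedSpace X, edist z .posInf < η → t < z.time := by
    intro ε hε
    have hε2 : 0 < ε / 2 := ENNReal.half_pos hε.ne'
    obtain ⟨T, hT, hTε⟩ := exists_edist_posInf_lt_of_time_ge (X := X) hsqz hε2
    obtain ⟨t, hTt, htc⟩ := f.cadlag.exists_gt_leftLim_eq hT
    obtain ⟨η, hη, h⟩ := exists_time_gt_of_edist_posInf_lt (X := X) hsqz t
    exact ⟨t, hT.trans_lt hTt, htc, fun z hz => hTε z ((EReal.coe_le_coe hTt.le).trans hz),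
      min η (ε / 2), lt_min hη hε2, min_le_right _ _,
      fun z hz => h z (hz.trans_le (min_le_left _ _))⟩
  refine ⟨⟨fun h t ht htc => ENNReal.tendsto_nhds_zero.2 fun ε hε => ?_,
      fun h => ENNReal.tendsto_nhds_zero.2 fun ε hε => ?_⟩,
    fun h t ht htc => ENNReal.tendsto_nhds_zero.2 fun ε hε => ?_,
      fun h => ENNReal.tendsto_nhds_zero.2 fun ε hε => ?_⟩
  · obtain ⟨η, hη, hηε, hnear⟩ := restrict t ht htc ε hε
    filter_upwards [h.eventually_lt_const hη] with n hn
    obtain ⟨R, hR, hRη⟩ := exists_correspondence_of_hausdorffEDist_lt hn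
    obtain ⟨R', hR', -, h'⟩ := exists_correspondence_restrictTo (t := ⟨t, ht.le⟩)
      f.cadlag (fn n).cadlag hηε hnear hR hRη
    exact hR'.hausdorffEDist_le (by rwa [ENNReal.add_thirds] at h')
  · obtain ⟨t, ht, htc, hfar, η, hη, hηε, hnear⟩ := extend ε hε
    filter_upwards [(h t ht htc).eventually_lt_const hη] with n hn
    obtain ⟨R, hR, hRη⟩ := exists_correspondence_of_hausdorffEDist_lt hn
    obtain ⟨R', hR', -, h'⟩ := exists_correspondence_of_restrictTo (t := ⟨t, ht.le⟩)
      f.cadlag (fn n).cadlag hηε hfar hnear hR hRη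
    exact hR'.hausdorffEDist_le (by rwa [ENNReal.add_halves] at h')
  · obtain ⟨η, hη, hηε, hnear⟩ := restrict t ht htc ε hε
    filter_upwards [h.eventually_lt_const hη] with n hn
    obtain ⟨R, ⟨hR, hmon⟩, hRη⟩ := exists_correspondence_of_orderedHausdorffEDist_lt hn
    obtain ⟨R', hR', hmon', h'⟩ := exists_correspondence_restrictTo (t := ⟨t, ht.le⟩)
      f.cadlag (fn n).cadlag hηε hnear hR hRη
    exact hR'.orderedHausdorffEDist_le (hmon' hmon) (by rwa [ENNReal.add_thirds] at h')
  · obtain ⟨t, ht, htc, hfar, η, hη, hηε, hnear⟩ := extend ε hε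
    filter_upwards [(h t ht htc).eventually_lt_const hη] with n hn
    obtain ⟨R, ⟨hR, hmon⟩, hRη⟩ := exists_correspondence_of_orderedHausdorffEDist_lt hn
    obtain ⟨R', hR', hmon', h'⟩ := exists_correspondence_of_restrictTo (t := ⟨t, ht.le⟩)
      f.cadlag (fn n).cadlag hηε hfar hnear hR hRη
    exact hR'.orderedHausdorffEDist_le (hmon' hmon) (by rwa [ENNReal.add_halves] at h')
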